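/- For $k\ge 1$ and $n\ge 0$ let $p_{-k}(n)$ be the number of $k$-colored partitions of $n$, i.e. partitions of $n$ in which each part can appear in $k$ colors, and let $E_j=(q^j;q^j)_\infty=\prod_{n\ge1}(1-q^{jn})$. Define an infinite matrix $\{m(i,j)\}_{i,j\ge1}$ as follows. Its first five rows are $$\begin{pmatrix} 5&0&0&0&0&0&\cdots\\ 2\cdot5&5^3&0&0&0&0&\cdots\\ 9&3\cdot5^3&5^5&0&0&0&\cdots\\ 4&22\cdot5^2&4\cdot5^5&5^7&0&0&\cdots\\ 1&4\cdot5^3&8\cdot5^5&5^8&5^9&0&\cdots \end{pmatrix},$$ and for $i\ge6$ we put $m(i,1)=0$ and, for $j\ge2$, $$m(i,j)=25m(i-1,j-1)+25m(i-2,j-1)+15m(i-3,j-1)+5m(i-4,j-1)+m(i-5,j-1).$$ Define a second infinite matrix $\{c(j,k)\}_{j,k\ge1}$ by $c(1,1)=140$, $c(1,2)=49\cdot5^4$, $c(1,3)=21\cdot5^7$, $c(1,4)=91\cdot5^8$, $c(1,5)=7\cdot5^{11}$, $c(1,6)=5^{13}$, $c(1,k)=0$ for $k\ge7$, and, for $j\ge1$,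 $$c(j+1,k)=\begin{cases}\displaystyle\sum_{i=1}^{\infty}c(j,i)\,m(6i+6,\,i+k+1)&\text{if $j$ is odd},\\[2ex] \displaystyle\sum_{i=1}^{\infty}c(j,i)\,m(6i+7,\,i+k+1)&\text{if $j$ is even}\end{cases}$$ (these sums have only finitely many non-zero terms, since $m(i,j)=0$ for $i>5j$). **Theorem.** For every integer $j\ge1$, as identities of formal power series in $q$, $$\sum_{n=0}^{\infty}p_{-7}\!\left(5^{2j-1}n+\frac{13\cdot5^{2j-1}+7}{24}\right)q^n=\sum_{l=1}^{\infty}c(2j-1,l)\,q^{l-1}\frac{E_5^{6l-1}}{E_1^{6l+6}},$$ $$\sum_{n=0}^{\infty}p_{-7}\!\left(5^{2j}n+\frac{17\cdot5^{2j}+7}{24}\right)q^n=\sum_{l=1}^{\infty}c(2j,l)\,q^{l-1}\frac{E_5^{6l}}{E_1^{6l+7}}.$$ -/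

import Mathlib

open scoped PowerSeries.WithPiTopology

namespace ColoredPartitions

/-- A `k`-colored partition of `n`: a finite multiset of positive parts, each part carrying one of
`k` colors, whose parts add up to `n`. -/
@[ext]
structure ColoredPartition (k n : ℕ) where
  parts : Multiset (ℕ × Fin k)
  parts_pos : ∀ x ∈ parts, 0 < x.1
  parts_sum : (parts.map Prod.fst).sum = n

/-- There are finitely many `k`-colored partitions of `n`, so that counting them with `Nat.card`
is meaningful. -/
instance (k n : ℕ) : Finite (ColoredPartition k n) := by
  classical
  let B : Multiset (ℕ × Fin k) := n • ((Finset.range (n + 1)) ×ˢ (Finset.univ : Finset (Fin k))).val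
  have hB : ∀ P : ColoredPartition k n, P.parts ∈ Set.Iic B := by
    intro P
    rw [Set.mem_Iic, Multiset.le_iff_count]
    intro x
    by_cases hx : x ∈ P.parts
    · have h1 : x.1 ≤ n := by
        rw [← P.parts_sum]
        exact Multiset.single_le_sum (fun _ _ => Nat.zero_le _) _ (Multiset.mem_map_of_mem _ hx)
      have h2 : P.parts.count x ≤ n := by
        have h3 : P.parts.card ≤ (P.parts.map Prod.fst).sum := by
          have := Multiset.card_nsmul_le_sum (s := P.parts.map Prod.fst) (a := 1) (by
            intro y hy
            obtain ⟨z, hz, rfl⟩ := Multiset.mem_map.1 hy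
            exact P.parts_pos z hz)
          simpa using this
        exact (Multiset.count_le_card x P.parts).trans (h3.trans P.parts_sum.le)
      have h4 : ((Finset.range (n + 1)) ×ˢ (Finset.univ : Finset (Fin k))).val.count x = 1 := by
        rw [Multiset.count_eq_one_of_mem (Finset.nodup _)]
        simp only [Finset.mem_val, Finset.mem_product, Finset.mem_range, Finset.mem_univ, and_true]
        omega
      simpa only [B, Multiset.count_nsmul, h4, smul_eq_mul, mul_one] using h2
    · rw [Multiset.count_eq_zero_of_notMem hx]
      exact Nat.zero_le _
  have hfin : (Set.Iic B).Finite := Set.finite_Iic B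
  have : Finite (Set.Iic B) := hfin
  exact Finite.of_injective (fun P : ColoredPartition k n => (⟨P.parts, hB P⟩ : Set.Iic B))
    (fun P Q h => ColoredPartition.ext (congrArg Subtype.val h))

/-- `pNeg k n` is `p_{-k}(n)`, the number of `k`-colored partitions of `n`. -/
noncomputable def pNeg (k n : ℕ) : ℕ := Nat.card (ColoredPartition k n)

/-- `E j = (q^j; q^j)_∞ = ∏_{n ≥ 1} (1 - q^{jn})` as a formal power series in `q = X`. The product
converges coefficientwise for `j ≥ 1`. -/
noncomputable def E (j : ℕ) : PowerSeries ℚ :=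
  ∏' n : ℕ, (1 - (PowerSeries.X : PowerSeries ℚ) ^ (j * (n + 1)))

/-- The infinite matrix `m(i, j)`, `i, j ≥ 1`: its first five rows are given, and for `i ≥ 6` one
has `m(i, 1) = 0` and a linear recurrence for `j ≥ 2`. (Entries with an index `0` are set to `0`
and are not part of the matrix.) -/
def m : ℕ → ℕ → ℕ
  | 1, 1 => 5
  | 2, 1 => 2 * 5
  | 2, 2 => 5 ^ 3
  | 3, 1 => 9
  | 3, 2 => 3 * 5 ^ 3
  | 3, 3 => 5 ^ 5
  | 4, 1 => 4
  | 4, 2 => 22 * 5 ^ 2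
  | 4, 3 => 4 * 5 ^ 5
  | 4, 4 => 5 ^ 7
  | 5, 1 => 1
  | 5, 2 => 4 * 5 ^ 3
  | 5, 3 => 8 * 5 ^ 5
  | 5, 4 => 5 ^ 8
  | 5, 5 => 5 ^ 9
  | i + 6, j + 2 =>
      25 * m (i + 5) (j + 1) + 25 * m (i + 4) (j + 1) + 15 * m (i + 3) (j + 1)
        + 5 * m (i + 2) (j + 1) + m (i + 1) (j + 1)
  | _, _ => 0

/-- The matrix `c(j, k)`, `j, k ≥ 1`. The sums range over all `i ≥ 1`; only finitely many of their
terms are non-zero, see `finite_support_c`. (Entries with an index `0` are never used.) -/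
noncomputable def c : ℕ → ℕ → ℕ
  | 0, _ => 0
  | 1, k =>
      match k with
      | 1 => 140
      | 2 => 49 * 5 ^ 4
      | 3 => 21 * 5 ^ 7
      | 4 => 91 * 5 ^ 8
      | 5 => 7 * 5 ^ 11
      | 6 => 5 ^ 13
      | _ => 0
  | j + 2, k =>
      if Odd (j + 1) then
        ∑ᶠ i ∈ Set.Ici 1, c (j + 1) i * m (6 * i + 6) (i + k + 1)
      else
        ∑ᶠ i ∈ Set.Ici 1, c (j + 1) i * m (6 * i + 7) (i + k + 1)

theorem m_eq_zero_of_lt : ∀ i j : ℕ, 5 * j < i → m i j = 0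
  | i, 0, h => by
      match i, h with
      | 1, _ | 2, _ | 3, _ | 4, _ | 5, _ => rfl
      | i + 6, _ => simp [m]
  | i, 1, h => by
      obtain ⟨i, rfl⟩ : ∃ t, i = t + 6 := ⟨i - 6, by omega⟩
      simp [m]
  | i, j + 2, h => by
      obtain ⟨i, rfl⟩ : ∃ t, i = t + 6 := ⟨i - 6, by omega⟩
      rw [m, m_eq_zero_of_lt (i + 5) (j + 1) (by omega), m_eq_zero_of_lt (i + 4) (j + 1) (by omega),
        m_eq_zero_of_lt (i + 3) (j + 1) (by omega), m_eq_zero_of_lt (i + 2) (j + 1) (by omega),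
        m_eq_zero_of_lt (i + 1) (j + 1) (by omega)]

/-- The sums that define `c` (with `r = 6` and `r = 7`) are finite. -/
theorem finite_support_c (f : ℕ → ℕ) (r k : ℕ) :
    (Function.support fun i : ℕ => f i * m (6 * i + r) (i + k + 1)).Finite := by
  refine (Set.finite_Iic (5 * k + 5)).subset fun i hi => ?_
  by_contra hlt
  rw [Set.mem_Iic, not_le] at hlt
  exact hi (by simp [m_eq_zero_of_lt (6 * i + r) (i + k + 1) (by omega)])

/-- The divisions by `24` below are exact. -/
theorem dvd_index (j : ℕ) (hj : 1 ≤ j) :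
    24 ∣ 13 * 5 ^ (2 * j - 1) + 7 ∧ 24 ∣ 17 * 5 ^ (2 * j) + 7 := by
  obtain ⟨i, rfl⟩ : ∃ t, j = t + 1 := ⟨j - 1, by omega⟩
  have h : 5 ^ (2 * i) % 24 = 1 := by
    rw [pow_mul, Nat.pow_mod]
    simp
  have e1 : 2 * (i + 1) - 1 = 2 * i + 1 := by omega
  have e2 : 2 * (i + 1) = 2 * i + 2 := by omega
  rw [e1, e2, pow_succ, pow_add]
  omega

end ColoredPartitions

namespace ColoredPartitions

open PowerSeries

/-! The generating function of `p_{-7}` is `E₁⁻⁷`, and passing from one identity to the next means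
extracting one residue class of exponents modulo 5. So everything rests on the operator `U =
section5 0`, which keeps the exponents divisible by 5, acting on the powers of `x = q E₂₅ / E₁`. Put
`t = q E₅⁶ / E₁⁶`. The central formula, `section5_zero_pow`, is `U(xⁱ) = ∑ⱼ m(i, j) tʲ` for `i ≥ 1`.

Two facts give it. First, `x` is a root of a quintic over the series in `q⁵`: `x⁵ = t(q⁵) (1 + 5x +
15x² + 25x³ + 25x⁴)`. This is `modular_equation`, and since `U` is linear over series in `q⁵`, it
produces the recurrence of `m`. Second, `U(t(q⁵) x⁻ᵏ)` for `0 ≤ k ≤ 4` equals `t` times `1, -1, -1,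
5, -5` (from `section5_zero_X_pow_mul`); these values produce the first five rows.

Both facts come from the dissection `E₁ = a(q⁵) - q E₂₅ + q² c(q⁵)` together with `a c = -E₅²`. The
dissection is read off the pentagonal number theorem. The product relation is proved by a
sign-reversing reflection of the lattice points counted by `E₁²`. The quintic follows by computing
`∏ E₁(ζⁱ q)` over the fifth roots of unity `ζⁱ` in two ways: from the Euler product it is `E₅⁶ /
E₂₅`, from the dissection it is a polynomial in the components.

Multiplying a term of the expansion by powers of `q` and `q⁵` and by a power of `E₂₅` turns it into
a power of `x` times a series in `q⁵`, so the central formula turns one row of `c` into the next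
(`section5_term`). Row 7 of `m`, shifted by one column, is the first row of `c`. -/

/-! ### Continuity of substitutions, and Euler products as pentagonal series. -/

theorem continuous_of_coeff {R S : Type*} [Semiring R] [Semiring S] [TopologicalSpace R]
    [TopologicalSpace S] {F : R⟦X⟧ → S⟦X⟧} (h : ∀ n, Continuous fun f => coeff n (F f)) :
    Continuous F := by
  rw [continuous_iff_continuousAt]
  intro f
  rw [ContinuousAt, WithPiTopology.tendsto_iff_coeff_tendsto]
  exact fun n => (h n).tendsto f

theorem continuous_expand {R : Type*} [CommRing R] [TopologicalSpace R] (p : ℕ) (hp : p ≠ 0) :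
    Continuous (expand p hp : R⟦X⟧ → R⟦X⟧) := by
  refine continuous_of_coeff fun n => ?_
  simp only [coeff_expand]
  split_ifs
  · exact WithPiTopology.continuous_coeff _ _
  · exact continuous_const

theorem continuous_rescale {R : Type*} [CommRing R] [TopologicalSpace R] [IsTopologicalRing R]
    (a : R) : Continuous (rescale a : R⟦X⟧ → R⟦X⟧) := by
  refine continuous_of_coeff fun n => ?_
  simp only [coeff_rescale]
  exact continuous_const.mul (WithPiTopology.continuous_coeff _ _)

theorem E_one : E 1 = pentagonalSeries ℚ := by
  rw [← WithPiTopology.tprod_one_sub_X_pow]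
  simp [E]

theorem E_eq_expand (p : ℕ) (hp : p ≠ 0) : E p = expand p hp (E 1) := by
  have := (WithPiTopology.multipliable_one_sub_X_pow ℚ).map_tprod (expand p hp)
    (continuous_expand p hp)
  simp only [E, one_mul]
  rw [this]
  simp [pow_mul]

theorem constantCoeff_E (p : ℕ) (hp : p ≠ 0) : constantCoeff (E p) = 1 := by
  rw [E_eq_expand p hp, constantCoeff_expand, E_one, ← coeff_zero_eq_constantCoeff_apply]
  simpa [pentagonal_def] using coeff_pentagonalSeries_pentagonal ℚ 0

theorem E_pow_ne_zero (p : ℕ) (hp : p ≠ 0) (k : ℕ) : E p ^ k ≠ 0 := by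
  refine pow_ne_zero _ fun h => ?_
  simpa [h] using constantCoeff_E p hp

/-! ### The generating function of coloured partitions. -/

theorem mk_card_partition_mul_E_one :
    (PowerSeries.mk fun n => (Fintype.card (Nat.Partition n) : ℚ)) * E 1 = 1 := by
  have h := Nat.Partition.hasProd_powerSeriesMk_card_restricted ℚ (fun _ => True)
  have h2 := h.mul (WithPiTopology.multipliable_one_sub_X_pow ℚ).hasProd
  have h3 : (fun i : ℕ => (if True then ∑' j : ℕ, (X : ℚ⟦X⟧) ^ ((i + 1) * j) else 1) *
      (1 - X ^ (i + 1))) = fun _ => 1 := by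
    funext i
    simp only [if_true, pow_mul]
    exact WithPiTopology.tsum_pow_mul_one_sub_of_constantCoeff_eq_zero (by simp)
  rw [h3] at h2
  have h4 := h2.unique hasProd_one
  simpa [E, Nat.Partition.restricted] using h4

/-- Adding parts of a new colour to a coloured partition. -/
def addColor (k n : ℕ) :
    (Σ p : {p : ℕ × ℕ // p ∈ Finset.HasAntidiagonal.antidiagonal n},
      ColoredPartition k p.1.1 × Nat.Partition p.1.2) → ColoredPartition (k + 1) n :=
  fun x =>
    { parts := x.2.1.parts.map (Prod.map id Fin.castSucc) +
        x.2.2.parts.map fun a => (a, Fin.last k)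
      parts_pos := by
        intro y hy
        rcases Multiset.mem_add.1 hy with h | h
        · obtain ⟨z, hz, rfl⟩ := Multiset.mem_map.1 h
          exact x.2.1.parts_pos z hz
        · obtain ⟨z, hz, rfl⟩ := Multiset.mem_map.1 h
          exact x.2.2.parts_pos hz
      parts_sum := by
        have h := Finset.HasAntidiagonal.mem_antidiagonal.1 x.1.2
        simpa [Multiset.map_map, Function.comp_def, x.2.1.parts_sum, x.2.2.parts_sum] using h }

theorem exists_split_last {α : Type*} (k : ℕ) (s : Multiset (α × Fin (k + 1))) :
    ∃ (t : Multiset (α × Fin k)) (u : Multiset α),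
      s = t.map (Prod.map id Fin.castSucc) + u.map fun a => (a, Fin.last k) := by
  induction s using Multiset.induction with
  | empty => exact ⟨0, 0, by simp⟩
  | cons x s ih =>
    obtain ⟨t, u, rfl⟩ := ih
    obtain ⟨a, i⟩ := x
    induction i using Fin.lastCases with
    | last => exact ⟨t, a ::ₘ u, by simp⟩
    | cast i => exact ⟨(a, i) ::ₘ t, u, by simp⟩

theorem split_last_injective {α : Type*} (k : ℕ) {t t' : Multiset (α × Fin k)} {u u' : Multiset α}
    (h : t.map (Prod.map id Fin.castSucc) + u.map (fun a => (a, Fin.last k)) =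
      t'.map (Prod.map id Fin.castSucc) + u'.map fun a => (a, Fin.last k)) :
    t = t' ∧ u = u' := by
  have hl : ∀ (t : Multiset (α × Fin k)) (u : Multiset α),
      (t.map (Prod.map id Fin.castSucc) + u.map fun a => (a, Fin.last k)).filter
        (fun x => x.2 = Fin.last k) = u.map fun a => (a, Fin.last k) := by
    intro t u
    rw [Multiset.filter_add, Multiset.filter_eq_nil.2, Multiset.filter_eq_self.2, zero_add]
    · simp
    · intro x hx
      obtain ⟨y, -, rfl⟩ := Multiset.mem_map.1 hx
      simp [Fin.castSucc_ne_last]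
  have hu : (u.map fun a => (a, Fin.last k)) = u'.map fun a => (a, Fin.last k) := by
    rw [← hl t u, h, hl]
  rw [hu, add_left_inj] at h
  exact ⟨Multiset.map_injective (Function.injective_id.prodMap (Fin.castSucc_injective k)) h,
    Multiset.map_injective (fun a b hab => (Prod.ext_iff.1 hab).1) hu⟩

/-- Separating the parts of the last colour from the others inverts `addColor`. Hence each new
colour multiplies the generating function by that of ordinary partitions. -/
theorem addColor_bijective (k n : ℕ) : Function.Bijective (addColor k n) := by
  constructor
  · rintro ⟨⟨⟨a, b⟩, hab⟩, P, Q⟩ ⟨⟨⟨a', b'⟩, hab'⟩, P', Q'⟩ h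
    obtain ⟨h1, h2⟩ := split_last_injective k (congrArg ColoredPartition.parts h)
    dsimp only at P Q P' Q' h1 h2
    obtain rfl : a = a' := by rw [← P.parts_sum, ← P'.parts_sum, h1]
    obtain rfl : b = b' := by rw [← Q.parts_sum, ← Q'.parts_sum, h2]
    obtain rfl : P = P' := ColoredPartition.ext h1
    obtain rfl : Q = Q' := Nat.Partition.ext h2
    rfl
  · intro P
    obtain ⟨t, u, h⟩ := exists_split_last k P.parts
    refine ⟨⟨⟨((t.map Prod.fst).sum, u.sum), ?_⟩, ⟨t, fun x hx => ?_, rfl⟩,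
      ⟨u, fun {x} hx => ?_, rfl⟩⟩, ColoredPartition.ext h.symm⟩
    · have := P.parts_sum
      rw [h] at this
      simpa [Multiset.map_map, Function.comp_def] using this
    · exact P.parts_pos (x.1, x.2.castSucc) (by
        rw [h]
        exact Multiset.mem_add.2 (Or.inl (Multiset.mem_map.2 ⟨x, hx, rfl⟩)))
    · exact P.parts_pos (x, Fin.last k) (by
        rw [h]
        exact Multiset.mem_add.2 (Or.inr (Multiset.mem_map.2 ⟨x, hx, rfl⟩)))

theorem mk_pNeg (k : ℕ) : (PowerSeries.mk fun n => (pNeg k n : ℚ)) * E 1 ^ k = 1 := by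
  induction k with
  | zero =>
    ext n
    have h : pNeg 0 n = if n = 0 then 1 else 0 := by
      have key : ∀ P : ColoredPartition 0 n, P.parts = 0 := fun P =>
        Multiset.eq_zero_of_forall_notMem fun x => x.2.elim0
      split_ifs with hn
      · subst hn
        rw [pNeg, Nat.card_eq_one_iff_unique]
        exact ⟨⟨fun P Q => ColoredPartition.ext (by rw [key, key])⟩, ⟨⟨0, by simp, by simp⟩⟩⟩
      · rw [pNeg, Nat.card_eq_zero]
        refine Or.inl ⟨fun P => hn ?_⟩
        rw [← P.parts_sum, key]
        simp
    simp [h, coeff_one]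
  | succ k ih =>
    have h : (PowerSeries.mk fun n => (pNeg (k + 1) n : ℚ)) =
        (PowerSeries.mk fun n => (pNeg k n : ℚ)) *
          PowerSeries.mk fun n => (Fintype.card (Nat.Partition n) : ℚ) := by
      ext n
      rw [coeff_mul, coeff_mk, pNeg, ← Nat.card_congr (Equiv.ofBijective _ (addColor_bijective k n)),
        Nat.card_sigma]
      simp only [Nat.card_prod, Nat.cast_sum, Nat.cast_mul, Nat.card_eq_fintype_card, coeff_mk, pNeg]
      exact Finset.sum_coe_sort _ fun x : ℕ × ℕ =>
        (Nat.card (ColoredPartition k x.1) : ℚ) * (Fintype.card (Nat.Partition x.2) : ℚ)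
    rw [h, pow_succ]
    calc _ = ((PowerSeries.mk fun n => (pNeg k n : ℚ)) * E 1 ^ k) *
          ((PowerSeries.mk fun n => (Fintype.card (Nat.Partition n) : ℚ)) * E 1) := by ring
      _ = 1 := by rw [ih, mk_card_partition_mul_E_one, one_mul]

/-! ### Sections of a power series modulo 5. -/

/-- The power series `∑ f_{5n+r} X^n`. -/
noncomputable def section5 (r : ℕ) (f : ℚ⟦X⟧) : ℚ⟦X⟧ := PowerSeries.mk fun n => coeff (5 * n + r) f

@[simp]
theorem coeff_section5 (r n : ℕ) (f : ℚ⟦X⟧) : coeff n (section5 r f) = coeff (5 * n + r) f :=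
  coeff_mk _ _

/-- The substitution `X ↦ X^5`. -/
noncomputable abbrev expand5 : ℚ⟦X⟧ →ₐ[ℚ] ℚ⟦X⟧ := expand 5 (by norm_num)

theorem coeff_X_pow_mul_expand5 (r : ℕ) (hr : r < 5) (g : ℚ⟦X⟧) (N : ℕ) :
    coeff N (X ^ r * expand5 g) = if N % 5 = r then coeff (N / 5) g else 0 := by
  rw [coeff_X_pow_mul', coeff_expand]
  by_cases h : N % 5 = r
  · have h1 : r ≤ N := by omega
    have h2 : 5 ∣ N - r := by omega
    have h3 : (N - r) / 5 = N / 5 := by omega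
    simp [h, h1, h2, h3]
  · have h2 : r ≤ N → ¬ 5 ∣ N - r := by omega
    by_cases h1 : r ≤ N
    · simp [h, h1, h2 h1]
    · simp [h, h1]

theorem eq_sum_section5 (f : ℚ⟦X⟧) :
    f = ∑ r ∈ Finset.range 5, X ^ r * expand5 (section5 r f) := by
  ext N
  have h : N % 5 < 5 := Nat.mod_lt _ (by norm_num)
  rw [map_sum, Finset.sum_congr rfl fun r hr =>
    coeff_X_pow_mul_expand5 r (Finset.mem_range.1 hr) _ N,
    Finset.sum_ite_eq, if_pos (Finset.mem_range.2 h), coeff_section5, Nat.div_add_mod]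

theorem section5_sum (g : ℕ → ℚ⟦X⟧) (r : ℕ) (hr : r < 5) :
    section5 r (∑ s ∈ Finset.range 5, X ^ s * expand5 (g s)) = g r := by
  ext n
  have h : (5 * n + r) % 5 = r := by omega
  have h' : (5 * n + r) / 5 = n := by omega
  rw [coeff_section5, map_sum, Finset.sum_congr rfl fun r hr =>
    coeff_X_pow_mul_expand5 r (Finset.mem_range.1 hr) _ _,
    Finset.sum_ite_eq, h, h', if_pos (Finset.mem_range.2 hr)]

theorem section5_eq {f g₀ g₁ g₂ g₃ g₄ : ℚ⟦X⟧}
    (h : f = expand5 g₀ + X * expand5 g₁ + X ^ 2 * expand5 g₂ + X ^ 3 * expand5 g₃ +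
      X ^ 4 * expand5 g₄) :
    section5 0 f = g₀ ∧ section5 1 f = g₁ ∧ section5 2 f = g₂ ∧ section5 3 f = g₃ ∧
      section5 4 f = g₄ := by
  let g : ℕ → ℚ⟦X⟧ := fun n => [g₀, g₁, g₂, g₃, g₄].getD n 0
  have hf : f = ∑ s ∈ Finset.range 5, X ^ s * expand5 (g s) := by
    simp [h, Finset.sum_range_succ, g]
  rw [hf]
  exact ⟨section5_sum g 0 (by norm_num), section5_sum g 1 (by norm_num),
    section5_sum g 2 (by norm_num), section5_sum g 3 (by norm_num),
    section5_sum g 4 (by norm_num)⟩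

/-! ### The 5-dissection of `E 1`. -/

theorem pentagonal_mod_five (k : ℤ) :
    (pentagonal k % 5 = 0 ∨ pentagonal k % 5 = 1 ∨ pentagonal k % 5 = 2) ∧
      (pentagonal k % 5 = 1 ↔ k % 5 = 1) := by
  have h := two_mul_natCast_pentagonal k
  generalize pentagonal k = a at *
  have h5 : k % 5 = 0 ∨ k % 5 = 1 ∨ k % 5 = 2 ∨ k % 5 = 3 ∨ k % 5 = 4 := by omega
  obtain ⟨t, ht⟩ : ∃ t, k = 5 * t + k % 5 := ⟨k / 5, by omega⟩
  rcases h5 with h5 | h5 | h5 | h5 | h5 <;> rw [h5] at ht <;> subst ht <;> ring_nf at h <;> omega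

theorem section5_E_one_eq_zero (r : ℕ) (hr : r = 3 ∨ r = 4) : section5 r (E 1) = 0 := by
  ext n
  rw [coeff_section5, E_one, coeff_pentagonalSeries_eq_zero, map_zero]
  rintro ⟨k, hk⟩
  have := (pentagonal_mod_five k).1
  omega

theorem section5_one_E_one : section5 1 (E 1) = -E 5 := by
  -- The indices `k = 5t + 1` are exactly those with pentagonal number `≡ 1` modulo 5. The sign of
  -- index `5t + 1` is opposite to that of `-t`, which yields the minus sign.
  have key : ∀ t : ℤ, pentagonal (5 * t + 1) = 5 * (5 * pentagonal (-t)) + 1 := by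
    intro t
    have h1 := two_mul_natCast_pentagonal (5 * t + 1)
    have h2 := two_mul_natCast_pentagonal_neg t
    zify
    linarith
  ext n
  rw [coeff_section5, E_eq_expand 5 (by norm_num), map_neg, E_one]
  by_cases h : ∃ t : ℤ, n = 5 * pentagonal (-t)
  · obtain ⟨t, rfl⟩ := h
    rw [← key, coeff_expand_mul, coeff_pentagonalSeries_pentagonal,
      coeff_pentagonalSeries_pentagonal]
    rcases Int.even_or_odd t with ht | ht
    · rw [Int.negOnePow_odd _ (by grind), Int.negOnePow_even _ (by grind)]
      simp
    · rw [Int.negOnePow_even _ (by grind), Int.negOnePow_odd _ (by grind)]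
      simp
  · rw [coeff_pentagonalSeries_eq_zero, coeff_expand]
    · split_ifs with h5
      · rw [coeff_pentagonalSeries_eq_zero, neg_zero]
        rintro ⟨k, hk⟩
        exact h ⟨-k, by rw [neg_neg]; omega⟩
      · rw [neg_zero]
    · rintro ⟨k, hk⟩
      have h1 : k % 5 = 1 := (pentagonal_mod_five k).2.1 (by omega)
      obtain ⟨t, rfl⟩ : ∃ t, k = 5 * t + 1 := ⟨k / 5, by omega⟩
      rw [key] at hk
      exact h ⟨t, by omega⟩

/-! ### The product of the outer components, by a sign-reversing reflection. -/

theorem prodMap_pentagonal_injective :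
    Function.Injective (Prod.map pentagonal pentagonal) :=
  pentagonal_injective.prodMap pentagonal_injective

/-- The pairs of indices of generalized pentagonal numbers with sum `N`. -/
noncomputable def pentagonalPairs (N : ℕ) : Finset (ℤ × ℤ) :=
  (Finset.HasAntidiagonal.antidiagonal N).preimage (Prod.map pentagonal pentagonal)
    prodMap_pentagonal_injective.injOn

theorem mem_pentagonalPairs {N : ℕ} {p : ℤ × ℤ} :
    p ∈ pentagonalPairs N ↔ p.1 * (3 * p.1 - 1) + p.2 * (3 * p.2 - 1) = 2 * N := by
  rw [pentagonalPairs, Finset.mem_preimage, Finset.HasAntidiagonal.mem_antidiagonal,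
    ← two_mul_natCast_pentagonal, ← two_mul_natCast_pentagonal]
  simp only [Prod.map_fst, Prod.map_snd]
  omega

/-- The sign attached to a pair of indices. -/
def pairSign (p : ℤ × ℤ) : ℚ := ((p.1 + p.2).negOnePow : ℤ)

theorem sum_antidiagonal_pentagonal (N : ℕ) (P : ℕ → Prop) [DecidablePred P] :
    ∑ p ∈ Finset.HasAntidiagonal.antidiagonal N,
      (if P p.1 then coeff p.1 (E 1) else 0) * (if P p.2 then coeff p.2 (E 1) else 0) =
    ∑ p ∈ pentagonalPairs N with P (pentagonal p.1) ∧ P (pentagonal p.2), pairSign p := by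
  rw [Finset.sum_filter, pentagonalPairs, ← Finset.sum_preimage (Prod.map pentagonal pentagonal) _
    prodMap_pentagonal_injective.injOn]
  · refine Finset.sum_congr rfl fun p _ => ?_
    simp only [Prod.map_fst, Prod.map_snd, E_one, coeff_pentagonalSeries_pentagonal, pairSign,
      Int.negOnePow_add]
    by_cases h1 : P (pentagonal p.1) <;> by_cases h2 : P (pentagonal p.2) <;> simp [h1, h2]
  · rintro ⟨x, y⟩ - h
    simp only [E_one]
    by_cases hx : x ∈ Set.range pentagonal
    · by_cases hy : y ∈ Set.range pentagonal
      · obtain ⟨i, rfl⟩ := hx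
        obtain ⟨j, rfl⟩ := hy
        exact absurd ⟨(i, j), rfl⟩ h
      · simp [coeff_pentagonalSeries_eq_zero ℚ hy]
    · simp [coeff_pentagonalSeries_eq_zero ℚ hx]

/-- In the coordinates `u = 6i - 1`, `v = 6j - 1` the pairs lie on the circle `u² + v² = 24N + 2`.
The involution is the reflection `(u, v) ↦ ((-3u - 4v)/5, (-4u + 3v)/5)`; the congruence says that
it is integral, and it reverses the sign. -/
theorem sum_pairSign_left (N : ℕ) :
    ∑ p ∈ pentagonalPairs N with 5 ∣ 3 * p.1 + 4 * p.2 - 2, pairSign p = 0 := by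
  have key : ∀ p : ℤ × ℤ, 5 ∣ 3 * p.1 + 4 * p.2 - 2 →
      5 * ((2 - 3 * p.1 - 4 * p.2) / 5) = 2 - 3 * p.1 - 4 * p.2 ∧
      5 * ((3 * p.2 - 4 * p.1 + 1) / 5) = 3 * p.2 - 4 * p.1 + 1 := by
    intro p hp
    omega
  have hs : ∀ p : ℤ × ℤ, 5 ∣ 3 * p.1 + 4 * p.2 - 2 → pairSign p +
      pairSign ((2 - 3 * p.1 - 4 * p.2) / 5, (3 * p.2 - 4 * p.1 + 1) / 5) = 0 := by
    intro p hp
    obtain ⟨h1, h2⟩ := key p hp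
    unfold pairSign
    rcases Int.even_or_odd (p.1 + p.2) with h | h
    · have h' : Odd ((2 - 3 * p.1 - 4 * p.2) / 5 + (3 * p.2 - 4 * p.1 + 1) / 5) := by
        rw [Int.even_iff] at h
        rw [Int.odd_iff]
        omega
      rw [Int.negOnePow_even _ h, Int.negOnePow_odd _ h']
      simp
    · have h' : Even ((2 - 3 * p.1 - 4 * p.2) / 5 + (3 * p.2 - 4 * p.1 + 1) / 5) := by
        rw [Int.odd_iff] at h
        rw [Int.even_iff]
        omega
      rw [Int.negOnePow_odd _ h, Int.negOnePow_even _ h']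
      simp
  refine Finset.sum_involution
    (fun p _ => ((2 - 3 * p.1 - 4 * p.2) / 5, (3 * p.2 - 4 * p.1 + 1) / 5)) ?_ ?_ ?_ ?_
  · intro p hp
    exact hs p (Finset.mem_filter.1 hp).2
  · intro p hp h0 heq
    have := hs p (Finset.mem_filter.1 hp).2
    rw [heq] at this
    exact h0 (by linarith)
  · intro p hp
    obtain ⟨hp1, hp2⟩ := Finset.mem_filter.1 hp
    obtain ⟨h1, h2⟩ := key p hp2
    rw [mem_pentagonalPairs] at hp1
    rw [Finset.mem_filter, mem_pentagonalPairs]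
    dsimp only
    generalize (2 - 3 * p.1 - 4 * p.2) / 5 = u at *
    generalize (3 * p.2 - 4 * p.1 + 1) / 5 = v at *
    refine ⟨?_, by omega⟩
    obtain ⟨i, j⟩ := p
    dsimp only at *
    have e1 : 25 * (u * (3 * u - 1) + v * (3 * v - 1)) = 25 * (2 * N) := by
      rw [← hp1]
      have e2 : 25 * (u * (3 * u - 1) + v * (3 * v - 1)) =
        (5 * u) * (3 * (5 * u) - 5) + (5 * v) * (3 * (5 * v) - 5) := by ring
      rw [e2, h1, h2]
      ring
    linarith
  · intro p hp
    obtain ⟨h1, h2⟩ := key p (Finset.mem_filter.1 hp).2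
    ext <;> dsimp only <;> omega

theorem sum_pairSign_right (N : ℕ) :
    ∑ p ∈ pentagonalPairs N with 5 ∣ 3 * p.2 + 4 * p.1 - 2, pairSign p = 0 := by
  rw [← sum_pairSign_left N]
  refine Finset.sum_equiv (Equiv.prodComm ℤ ℤ) (fun p => ?_) (fun p _ => ?_)
  · simp [mem_pentagonalPairs, add_comm]
  · simp [pairSign, add_comm]

/-- Inclusion-exclusion: every pair admits the reflection or its mirror image under swapping
coordinates, and both of those sums vanish. The pairs admitting both are the ones coming from the
middle component of the dissection. -/
theorem sum_pairSign (n : ℕ) :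
    ∑ p ∈ pentagonalPairs (5 * n + 2), pairSign p =
      -∑ p ∈ pentagonalPairs (5 * n + 2) with
        pentagonal p.1 % 5 = 1 ∧ pentagonal p.2 % 5 = 1, pairSign p := by
  have hmod : ∀ p ∈ pentagonalPairs (5 * n + 2),
      (5 ∣ 3 * p.1 + 4 * p.2 - 2 ∨ 5 ∣ 3 * p.2 + 4 * p.1 - 2) ∧
      ((pentagonal p.1 % 5 = 1 ∧ pentagonal p.2 % 5 = 1) ↔
        (5 ∣ 3 * p.1 + 4 * p.2 - 2 ∧ 5 ∣ 3 * p.2 + 4 * p.1 - 2)) := by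
    rintro ⟨i, j⟩ hp
    rw [mem_pentagonalPairs] at hp
    rw [(pentagonal_mod_five i).2, (pentagonal_mod_five j).2]
    dsimp only at *
    -- With `u`, `v` as above, this is `(3u + 4v)(4u + 3v) ≡ 12(u² + v²)` modulo 5, and `u² + v² =
    -- 24(5n + 2) + 2` is divisible by 5.
    have hprod : (5 : ℤ) ∣ (3 * i + 4 * j - 2) * (3 * j + 4 * i - 2) := by
      push_cast at hp
      exact ⟨8 * n + 4 - 2 * i - 2 * j + 5 * i * j, by linear_combination 4 * hp⟩
    refine ⟨Int.Prime.dvd_mul' (by norm_num) hprod, by omega⟩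
  have h := Finset.sum_union_inter
    (s₁ := {p ∈ pentagonalPairs (5 * n + 2) | 5 ∣ 3 * p.1 + 4 * p.2 - 2})
    (s₂ := {p ∈ pentagonalPairs (5 * n + 2) | 5 ∣ 3 * p.2 + 4 * p.1 - 2}) (f := pairSign)
  rw [sum_pairSign_left, sum_pairSign_right, ← Finset.filter_or, ← Finset.filter_and,
    Finset.filter_true_of_mem fun p hp => (hmod p hp).1,
    ← Finset.filter_congr fun p hp => (hmod p hp).2] at h
  linarith

theorem E_one_dissection :
    E 1 = expand5 (section5 0 (E 1)) - X * expand5 (E 5) +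
      X ^ 2 * expand5 (section5 2 (E 1)) := by
  conv_lhs => rw [eq_sum_section5 (E 1)]
  simp only [Finset.sum_range_succ, Finset.sum_range_zero, section5_E_one_eq_zero 3 (Or.inl rfl),
    section5_E_one_eq_zero 4 (Or.inr rfl), section5_one_E_one, map_neg, map_zero]
  ring

/-- With `a`, `c` the two outer components, the section of `E₁²` at residue 2 is `2ac + E₅²` by the
dissection. By the reflection argument it is also minus the contribution `E₅²` of the middle
component. -/
theorem section5_zero_mul_section5_two :
    section5 0 (E 1) * section5 2 (E 1) = -E 5 ^ 2 := by
  have h1 : section5 2 (E 1 * E 1) = 2 * (section5 0 (E 1) * section5 2 (E 1)) + E 5 ^ 2 := by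
    refine (section5_eq (g₀ := section5 0 (E 1) ^ 2)
      (g₁ := -2 * section5 0 (E 1) * E 5) (g₃ := -2 * E 5 * section5 2 (E 1))
      (g₄ := section5 2 (E 1) ^ 2) ?_).2.2.1
    conv_lhs => rw [E_one_dissection]
    simp only [map_neg, map_mul, map_add, map_pow, map_ofNat]
    ring
  have hb : ∀ N, coeff N (X ^ 1 * expand5 (section5 1 (E 1))) =
      if N % 5 = 1 then coeff N (E 1) else 0 := by
    intro N
    rw [coeff_X_pow_mul_expand5 1 (by norm_num)]
    split_ifs with h
    · rw [coeff_section5]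
      congr 2
      omega
    · rfl
  have h2 : section5 2 (E 1 * E 1) = -E 5 ^ 2 := by
    have h3 : section5 2 ((X ^ 1 * expand5 (section5 1 (E 1))) *
        (X ^ 1 * expand5 (section5 1 (E 1)))) = E 5 ^ 2 := by
      refine (section5_eq (g₀ := 0) (g₁ := 0) (g₃ := 0) (g₄ := 0) ?_).2.2.1
      rw [section5_one_E_one]
      simp only [map_neg, map_zero, map_pow]
      ring
    rw [← h3]
    ext n
    rw [map_neg, coeff_section5, coeff_section5, coeff_mul, coeff_mul]
    simp only [hb]
    rw [sum_antidiagonal_pentagonal _ fun N => N % 5 = 1, ← sum_pairSign]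
    simpa using sum_antidiagonal_pentagonal (5 * n + 2) fun _ => True
  have h4 : (2 : ℚ⟦X⟧) * (section5 0 (E 1) * section5 2 (E 1) + E 5 ^ 2) = 0 := by
    linear_combination h2 - h1
  rcases mul_eq_zero.1 h4 with h | h
  · have h0 := congrArg constantCoeff h
    rw [map_ofNat, map_zero] at h0
    norm_num at h0
  · linear_combination h

/-! ### Products over fifth roots of unity, and the modular equation. -/

/-- The factors for `z` and `z⁴`, and for `z²` and `z³`, pair up into expressions in the Gaussian
periods `u = z + z⁴` and `v = z² + z³`, whose sum and product are both `-1`. -/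
theorem prod_add_root {R : Type*} [CommRing R] {z : R}
    (hz : 1 + z + z ^ 2 + z ^ 3 + z ^ 4 = 0) (a b c : R) :
    (a + b + c) * (a + z * b + z ^ 2 * c) * (a + z ^ 2 * b + (z ^ 2) ^ 2 * c) *
      (a + z ^ 3 * b + (z ^ 3) ^ 2 * c) * (a + z ^ 4 * b + (z ^ 4) ^ 2 * c) =
    a ^ 5 + b ^ 5 + c ^ 5 - 5 * a * b ^ 3 * c + 5 * a ^ 2 * b * c ^ 2 := by
  have h5 : z ^ 5 = 1 := by linear_combination (z - 1) * hz
  obtain ⟨u, hu⟩ : ∃ u, u = z + z ^ 4 := ⟨_, rfl⟩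
  obtain ⟨v, hv⟩ : ∃ v, v = z ^ 2 + z ^ 3 := ⟨_, rfl⟩
  have huv : u + v = -1 := by linear_combination hu + hv + hz
  have huv' : u * v = -1 := by
    subst hu hv
    linear_combination hz + (z + z ^ 2) * h5
  have h1 : (a + z * b + z ^ 2 * c) * (a + z ^ 4 * b + (z ^ 4) ^ 2 * c) =
      a ^ 2 + b ^ 2 + c ^ 2 + u * (a * b + b * c) + v * (a * c) := by
    subst hu hv
    linear_combination
      (b ^ 2 + c ^ 2 * (z ^ 5 + 1) + a * c * z ^ 3 + b * c * (z ^ 4 + z)) * h5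
  have h2 : (a + z ^ 2 * b + (z ^ 2) ^ 2 * c) * (a + z ^ 3 * b + (z ^ 3) ^ 2 * c) =
      a ^ 2 + b ^ 2 + c ^ 2 + v * (a * b + b * c) + u * (a * c) := by
    subst hu hv
    linear_combination
      (b ^ 2 + c ^ 2 * (z ^ 5 + 1) + a * c * z + b * c * (z ^ 3 + z ^ 2)) * h5
  calc _ = (a + b + c) * ((a + z * b + z ^ 2 * c) * (a + z ^ 4 * b + (z ^ 4) ^ 2 * c)) *
        ((a + z ^ 2 * b + (z ^ 2) ^ 2 * c) * (a + z ^ 3 * b + (z ^ 3) ^ 2 * c)) := by ring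
    _ = _ := by
      rw [h1, h2]
      linear_combination (a + b + c) * ((a ^ 2 + b ^ 2 + c ^ 2) * (a * b + b * c + a * c) +
        (a * b + b * c) * (a * c) * (u + v - 1)) * huv +
        (a + b + c) * ((a * b + b * c) ^ 2 + (a * c) ^ 2 - 2 * (a * b + b * c) * (a * c)) * huv'

theorem prod_one_sub_root {R : Type*} [CommRing R] {z : R}
    (hz : 1 + z + z ^ 2 + z ^ 3 + z ^ 4 = 0) (x : R) :
    (1 - x) * (1 - z * x) * (1 - z ^ 2 * x) * (1 - z ^ 3 * x) * (1 - z ^ 4 * x) = 1 - x ^ 5 := by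
  linear_combination prod_add_root hz 1 (-x) 0

theorem geom_pow_eq_zero {R : Type*} [CommRing R] {z : R}
    (hz : 1 + z + z ^ 2 + z ^ 3 + z ^ 4 = 0) {k : ℕ} (hk : ¬ 5 ∣ k) :
    1 + z ^ k + (z ^ k) ^ 2 + (z ^ k) ^ 3 + (z ^ k) ^ 4 = 0 := by
  have h5 : z ^ 5 = 1 := by linear_combination (z - 1) * hz
  have hmod : z ^ k = z ^ (k % 5) := by
    conv_lhs => rw [← Nat.div_add_mod k 5, pow_add, pow_mul, h5, one_pow, one_mul]
  rw [hmod]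
  have : k % 5 = 1 ∨ k % 5 = 2 ∨ k % 5 = 3 ∨ k % 5 = 4 := by omega
  rcases this with h | h | h | h <;> rw [h]
  · linear_combination hz
  · linear_combination hz + (z + z ^ 3) * h5
  · linear_combination hz + (z + z ^ 4 + z ^ 2 * (z ^ 5 + 1)) * h5
  · linear_combination hz + (z ^ 3 + z ^ 2 * (z ^ 5 + 1) + z * (z ^ 10 + z ^ 5 + 1)) * h5

/-- Padding with ones lets products over multiples of 5 be compared factor by factor with products
over all exponents. -/
theorem hasProd_ite_dvd {R : Type*} [CommRing R] [TopologicalSpace R] {f : ℕ → R⟦X⟧} {a : R⟦X⟧}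
    (h : HasProd (fun n => f (5 * (n + 1))) a) :
    HasProd (fun n => if 5 ∣ n + 1 then f (n + 1) else 1) a := by
  have hinj : Function.Injective fun n : ℕ => 5 * n + 4 := fun m n h => by
    dsimp only at h
    omega
  rw [← hinj.hasProd_iff]
  · convert h using 2 with n
    have : 5 ∣ 5 * n + 4 + 1 := by omega
    simp [this, mul_add]
  · intro n hn
    rw [if_neg]
    intro h5
    exact hn ⟨n / 5, by dsimp only; omega⟩

/-- For `5 ∤ n` the five factors `1 - zⁱⁿ qⁿ` multiply to `1 - q⁵ⁿ`; for `5 ∣ n` they give `(1 -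
qⁿ)⁵`. -/
theorem prod_rescale_pentagonalSeries {z : ℂ} (hz : 1 + z + z ^ 2 + z ^ 3 + z ^ 4 = 0) :
    (∏ i ∈ Finset.range 5, rescale (z ^ i) (pentagonalSeries ℂ)) *
      expand 25 (by norm_num) (pentagonalSeries ℂ) =
    expand 5 (by norm_num) (pentagonalSeries ℂ) ^ 6 := by
  have hE := (WithPiTopology.multipliable_one_sub_X_pow ℂ).hasProd
  rw [WithPiTopology.tprod_one_sub_X_pow] at hE
  have hexp : ∀ (p : ℕ) (hp : p ≠ 0), HasProd (fun n => (1 : ℂ⟦X⟧) - X ^ (p * (n + 1)))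
      (expand p hp (pentagonalSeries ℂ)) := by
    intro p hp
    simpa [Function.comp_def, ← pow_mul] using hE.map (expand p hp) (continuous_expand p hp)
  have hres : ∀ a : ℂ, HasProd (fun n => (1 : ℂ⟦X⟧) - C (a ^ (n + 1)) * X ^ (n + 1))
      (rescale a (pentagonalSeries ℂ)) := by
    intro a
    simpa [Function.comp_def, rescale_X, mul_pow] using hE.map (rescale a) (continuous_rescale a)
  have h1 := (hasProd_prod fun i (_ : i ∈ Finset.range 5) => hres (z ^ i)).mul
    (hasProd_ite_dvd (f := fun n => (1 : ℂ⟦X⟧) - X ^ (5 * n))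
      (a := expand 25 (by norm_num) (pentagonalSeries ℂ)) (by
      simpa [← mul_assoc] using hexp 25 (by norm_num)))
  have hk : HasProd (fun n => if 5 ∣ n + 1 then (1 : ℂ⟦X⟧) - X ^ (n + 1) else 1)
      (expand 5 (by norm_num) (pentagonalSeries ℂ)) :=
    hasProd_ite_dvd (f := fun n => 1 - X ^ n) (hexp 5 (by norm_num))
  have h2 := (hexp 5 (by norm_num)).mul (hasProd_prod fun i (_ : i ∈ Finset.range 5) => hk)
  rw [Finset.prod_const, Finset.card_range, ← pow_succ'] at h2
  refine h1.unique ?_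
  convert h2 using 2 with n
  by_cases h5 : 5 ∣ n + 1
  · have hz5 : z ^ (n + 1) = 1 := by
      obtain ⟨k, hk⟩ := h5
      rw [hk, pow_mul, show z ^ 5 = 1 by linear_combination (z - 1) * hz, one_pow]
    have hz5' : ∀ i, (z ^ i) ^ (n + 1) = 1 := fun i => by
      rw [← pow_mul, mul_comm, pow_mul, hz5, one_pow]
    simp [h5, hz5', mul_comm]
  · have hC : ∀ i, C ((z ^ i) ^ (n + 1)) = (C (z ^ (n + 1)) : ℂ⟦X⟧) ^ i := fun i => by
      rw [← map_pow, ← pow_mul, ← pow_mul, mul_comm]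
    have hy : 1 + C (z ^ (n + 1)) + (C (z ^ (n + 1))) ^ 2 + (C (z ^ (n + 1))) ^ 3 +
        (C (z ^ (n + 1)) : ℂ⟦X⟧) ^ 4 = 0 := by
      simpa only [map_add, map_one, map_pow, map_zero] using
        congrArg (C : ℂ → ℂ⟦X⟧) (geom_pow_eq_zero hz h5)
    simp only [hC, h5, if_false, mul_one, Finset.prod_range_succ, Finset.prod_range_zero, one_mul,
      pow_zero, pow_one]
    rw [prod_one_sub_root hy, mul_comm 5, pow_mul]

theorem map_pentagonalSeries {R S : Type*} [CommRing R] [CommRing S] (f : R →+* S) :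
    PowerSeries.map f (pentagonalSeries R) = pentagonalSeries S := by
  ext n
  rw [coeff_map]
  by_cases h : n ∈ Set.range pentagonal
  · obtain ⟨k, rfl⟩ := h
    simp
  · rw [coeff_pentagonalSeries_eq_zero R h, coeff_pentagonalSeries_eq_zero S h, map_zero]

theorem rescale_map_X_pow_mul_expand5 {z : ℂ} (hz : z ^ 5 = 1) (r : ℕ) (hr : r < 5) (g : ℚ⟦X⟧) :
    rescale z (PowerSeries.map (algebraMap ℚ ℂ) (X ^ r * expand5 g)) =
      C z ^ r * PowerSeries.map (algebraMap ℚ ℂ) (X ^ r * expand5 g) := by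
  ext N
  rw [coeff_rescale, ← map_pow, coeff_C_mul, coeff_map, coeff_X_pow_mul_expand5 r hr]
  split_ifs with h
  · have hN : z ^ N = z ^ r := by
      conv_lhs => rw [← Nat.div_add_mod N 5, pow_add, pow_mul, hz, one_pow, one_mul, h]
    rw [hN]
  · simp

theorem expand25_mul_of_dissection {z : ℂ} (hz : 1 + z + z ^ 2 + z ^ 3 + z ^ 4 = 0)
    {a b c : ℂ⟦X⟧}
    (hres : ∀ i, rescale (z ^ i) (pentagonalSeries ℂ) = a + C z ^ i * b + (C z ^ i) ^ 2 * c)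
    (hac : a * c = -b ^ 2) :
    expand 25 (by norm_num) (pentagonalSeries ℂ) * (a ^ 5 + 11 * b ^ 5 + c ^ 5) =
      expand 5 (by norm_num) (pentagonalSeries ℂ) ^ 6 := by
  have hC : 1 + C z + C z ^ 2 + C z ^ 3 + (C z : ℂ⟦X⟧) ^ 4 = 0 := by
    simpa only [map_add, map_one, map_pow, map_zero] using congrArg (C : ℂ → ℂ⟦X⟧) hz
  have h := prod_rescale_pentagonalSeries hz
  simp only [hres, Finset.prod_range_succ, Finset.prod_range_zero, one_mul, pow_zero, pow_one,
    one_pow] at h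
  rw [prod_add_root hC] at h
  rw [← h]
  -- Under `ac = -b²` each of the two mixed terms of the norm becomes `5b⁵`, whence the coefficient
  -- 11.
  linear_combination expand 25 (by norm_num) (pentagonalSeries ℂ) * b *
    (5 * b ^ 2 - 5 * (a * c - b ^ 2)) * hac

theorem expand5_E_five_mul :
    expand5 (E 5) * (expand5 (section5 0 (E 1)) ^ 5 - 11 * (X * expand5 (E 5)) ^ 5 +
      (X ^ 2 * expand5 (section5 2 (E 1))) ^ 5) = E 5 ^ 6 := by
  -- Complex coefficients serve only to supply a fifth root of unity; the identity descends to `ℚ`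
  -- by injectivity.
  obtain ⟨z, hz⟩ : ∃ z : ℂ, 1 + z + z ^ 2 + z ^ 3 + z ^ 4 = 0 := by
    have h := (Complex.isPrimitiveRoot_exp 5 (by norm_num)).geom_sum_eq_zero (by norm_num)
    exact ⟨_, by simpa [Finset.sum_range_succ] using h⟩
  have hz5 : z ^ 5 = 1 := by linear_combination (z - 1) * hz
  have hpent : PowerSeries.map (algebraMap ℚ ℂ) (E 1) = pentagonalSeries ℂ := by
    rw [E_one, map_pentagonalSeries]
  have hE5 : PowerSeries.map (algebraMap ℚ ℂ) (E 5) =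
      expand 5 (by norm_num) (pentagonalSeries ℂ) := by
    rw [E_eq_expand 5 (by norm_num), ← hpent, map_expand]
  have hE25 : PowerSeries.map (algebraMap ℚ ℂ) (expand5 (E 5)) =
      expand 25 (by norm_num) (pentagonalSeries ℂ) := by
    rw [map_expand, hE5, ← expand_mul]
  have hres : ∀ i, rescale (z ^ i) (pentagonalSeries ℂ) =
      PowerSeries.map (algebraMap ℚ ℂ) (X ^ 0 * expand5 (section5 0 (E 1))) +
      C z ^ i * PowerSeries.map (algebraMap ℚ ℂ) (X ^ 1 * expand5 (-E 5)) +
      (C z ^ i) ^ 2 * PowerSeries.map (algebraMap ℚ ℂ) (X ^ 2 * expand5 (section5 2 (E 1))) := by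
    intro i
    have hzi : (z ^ i) ^ 5 = 1 := by rw [← pow_mul, mul_comm, pow_mul, hz5, one_pow]
    have hE : E 1 = X ^ 0 * expand5 (section5 0 (E 1)) + X ^ 1 * expand5 (-E 5) +
        X ^ 2 * expand5 (section5 2 (E 1)) := by
      conv_lhs => rw [E_one_dissection]
      rw [map_neg]
      ring
    rw [← hpent]
    conv_lhs => rw [hE]
    rw [map_add, map_add, map_add, map_add,
      rescale_map_X_pow_mul_expand5 hzi 0 (by norm_num),
      rescale_map_X_pow_mul_expand5 hzi 1 (by norm_num),
      rescale_map_X_pow_mul_expand5 hzi 2 (by norm_num), pow_zero (C _), pow_one (C _), one_mul,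
      map_pow]
  have h := expand25_mul_of_dissection hz hres (by
    rw [← map_mul, ← map_pow, ← map_neg]
    congr 1
    have h := congrArg expand5 section5_zero_mul_section5_two
    simp only [map_mul, map_neg, map_pow] at h
    rw [map_neg]
    linear_combination X ^ 2 * h)
  rw [← hE5, ← hE25] at h
  apply PowerSeries.map_injective _ (algebraMap ℚ ℂ).injective
  rw [map_pow, ← h]
  simp only [map_mul, map_add, map_sub, map_pow, map_neg, map_ofNat]
  ring

/-- The modular equation of level five. -/
theorem modular_equation :
    E 5 ^ 6 = expand5 (E 5) * E 1 ^ 5 + 5 * X * expand5 (E 5) ^ 2 * E 1 ^ 4 +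
      15 * X ^ 2 * expand5 (E 5) ^ 3 * E 1 ^ 3 + 25 * X ^ 3 * expand5 (E 5) ^ 4 * E 1 ^ 2 +
      25 * X ^ 4 * expand5 (E 5) ^ 5 * E 1 := by
  have h := congrArg expand5 section5_zero_mul_section5_two
  simp only [map_mul, map_neg, map_pow] at h
  have hac : expand5 (section5 0 (E 1)) * (X ^ 2 * expand5 (section5 2 (E 1))) =
      -(X * expand5 (E 5)) ^ 2 := by
    linear_combination X ^ 2 * h
  clear h
  have hP := E_one_dissection
  rw [← expand5_E_five_mul]
  generalize expand5 (section5 0 (E 1)) = a at *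
  generalize X ^ 2 * expand5 (section5 2 (E 1)) = c at *
  generalize expand5 (E 5) = e at *
  have hs : a + c = E 1 + X * e := by
    rw [hP]
    ring
  -- The power sum is written in `a + c` and `ac`, both of which are known in terms of `E₁` and `q
  -- E₂₅`.
  have h5 : a ^ 5 + c ^ 5 =
      (a + c) ^ 5 - 5 * (a * c) * (a + c) ^ 3 + 5 * (a * c) ^ 2 * (a + c) := by ring
  calc e * (a ^ 5 - 11 * (X * e) ^ 5 + c ^ 5) = e * (a ^ 5 + c ^ 5 - 11 * (X * e) ^ 5) := by ring
    _ = _ := by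
      rw [h5, hs, hac]
      ring

/-! ### The operator `section5 0` and the rows of `m`. -/

/-- In each power of the dissection, the component at the relevant residue involves `a` and `c` only
through `ac = -E₅²`, so it collapses to a monomial. -/
theorem section5_zero_X_pow_mul :
    section5 0 (X ^ 5) = X ∧
    section5 0 (X ^ 4 * E 1) = - X * E 5 ∧
    section5 0 (X ^ 3 * E 1 ^ 2) = - X * E 5 ^ 2 ∧
    section5 0 (X ^ 2 * E 1 ^ 3) = 5 * X * E 5 ^ 3 ∧
    section5 0 (X * E 1 ^ 4) = - 5 * X * E 5 ^ 4 := by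
  have h := section5_zero_mul_section5_two
  have hP := E_one_dissection
  generalize section5 0 (E 1) = a at *
  generalize section5 2 (E 1) = c at *
  generalize E 5 = e at *
  rw [hP]
  refine ⟨?_, ?_, ?_, ?_, ?_⟩
  · refine (section5_eq (g₁ := 0) (g₂ := 0) (g₃ := 0) (g₄ := 0) ?_).1
    simp
  · refine (section5_eq (g₁ := X * c) (g₂ := 0) (g₃ := 0) (g₄ := a) ?_).1
    simp only [map_neg, map_mul, map_zero, expand_X]
    ring
  · rw [(section5_eq (g₀ := X * (e ^ 2 + 2 * (a * c))) (g₁ := X * (-2 * e * c)) (g₂ := X * c ^ 2)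
      (g₃ := a ^ 2) (g₄ := -2 * a * e) (by
        simp only [map_neg, map_mul, map_add, map_pow, map_ofNat, expand_X]
        ring)).1, h]
    ring
  · rw [(section5_eq (g₀ := X * (-6 * (a * c) * e - e ^ 3))
      (g₁ := X * (3 * a * c ^ 2 + 3 * e ^ 2 * c))
      (g₂ := a ^ 3 - 3 * X * e * c ^ 2) (g₃ := -3 * a ^ 2 * e + X * c ^ 3)
      (g₄ := 3 * a ^ 2 * c + 3 * a * e ^ 2) (by
        simp only [map_neg, map_mul, map_add, map_sub, map_pow, map_ofNat, expand_X]
        ring)).1, h]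
    ring
  · rw [(section5_eq (g₀ := X * (6 * (a * c) ^ 2 + 12 * (a * c) * e ^ 2 + e ^ 4))
      (g₁ := a ^ 4 - X * (12 * a * e * c ^ 2 + 4 * e ^ 3 * c))
      (g₂ := -4 * a ^ 3 * e + X * (4 * a * c ^ 3 + 6 * e ^ 2 * c ^ 2))
      (g₃ := 4 * a ^ 3 * c + 6 * a ^ 2 * e ^ 2 - 4 * X * e * c ^ 3)
      (g₄ := -12 * a ^ 2 * e * c - 4 * a * e ^ 3 + X * c ^ 4) (by
        simp only [map_neg, map_mul, map_add, map_sub, map_pow, map_ofNat, expand_X]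
        ring)).1, h]
    ring

theorem section5_add (r : ℕ) (f g : ℚ⟦X⟧) :
    section5 r (f + g) = section5 r f + section5 r g := by
  ext n
  simp

theorem section5_finsetSum {ι : Type*} (r : ℕ) (s : Finset ι) (f : ι → ℚ⟦X⟧) :
    section5 r (∑ i ∈ s, f i) = ∑ i ∈ s, section5 r (f i) :=
  map_sum (AddMonoidHom.mk' (section5 r) (section5_add r)) f s

/-- Series in `X⁵` act as scalars for the sections. -/
theorem section5_expand5_mul (r : ℕ) (hr : r < 5) (g f : ℚ⟦X⟧) :
    section5 r (expand5 g * f) = g * section5 r f := by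
  conv_lhs => rw [eq_sum_section5 f, Finset.mul_sum]
  rw [← section5_sum (fun s => g * section5 s f) r hr]
  congr 1
  refine Finset.sum_congr rfl fun s _ => ?_
  rw [map_mul]
  ring

theorem section5_natCast_mul (r : ℕ) (hr : r < 5) (a : ℕ) (f : ℚ⟦X⟧) :
    section5 r (a * f) = a * section5 r f := by
  simpa using section5_expand5_mul r hr (a : ℚ⟦X⟧) f

theorem X_sq_mul_section5 (r : ℕ) (hr : r < 5) (f : ℚ⟦X⟧) :
    X ^ 2 * section5 r f = section5 0 (X ^ (10 - r) * f) := by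
  ext n
  rw [coeff_X_pow_mul', coeff_section5, coeff_section5, coeff_X_pow_mul']
  by_cases h : 2 ≤ n
  · rw [if_pos h, if_pos (by omega)]
    congr 2
    omega
  · rw [if_neg h, if_neg (by omega)]

theorem E_mul_inv (p : ℕ) (hp : p ≠ 0) : E p * (E p)⁻¹ = 1 :=
  PowerSeries.mul_inv_cancel _ (by simp [constantCoeff_E p hp])

theorem E_pow_inv (p : ℕ) (hp : p ≠ 0) (n : ℕ) : (E p ^ n)⁻¹ = (E p)⁻¹ ^ n := by
  rw [PowerSeries.inv_eq_iff_mul_eq_one (by simp [constantCoeff_E p hp]), ← mul_pow, mul_comm,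
    E_mul_inv p hp, one_pow]

theorem pow_mul_pow_of_mul_eq_one {R : Type*} [CommMonoid R] {a b : R} (h : a * b = 1) (k n : ℕ) :
    a ^ k * b ^ (k + n) = b ^ n := by
  rw [pow_add, ← mul_assoc, ← mul_pow, h, one_pow, one_mul]

theorem m_zero_right (i : ℕ) : m i 0 = 0 := by
  match i with
  | 0 | 1 | 2 | 3 | 4 | 5 => rfl
  | i + 6 => simp [m]

/-- The zero column 0 makes the recurrence uniform: at `j = 0` it says that the first column
vanishes from row 6 on. -/
theorem m_succ_right (i j : ℕ) : m (i + 6) (j + 1) = 25 * m (i + 5) j + 25 * m (i + 4) j +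
    15 * m (i + 3) j + 5 * m (i + 2) j + m (i + 1) j := by
  match j with
  | 0 => simp [m, m_zero_right]
  | j + 1 => rw [m]

theorem m_eq_zero_of_gt (i j : ℕ) (h : i < j) : m i j = 0 := by
  induction i using Nat.strong_induction_on generalizing j with
  | _ i ih =>
    rcases i with _ | _ | _ | _ | _ | _ | i
    rotate_right
    · obtain ⟨j, rfl⟩ : ∃ k, j = k + 1 := ⟨j - 1, by omega⟩
      rw [m_succ_right, ih _ (by omega) j (by omega), ih _ (by omega) j (by omega),
        ih _ (by omega) j (by omega), ih _ (by omega) j (by omega), ih _ (by omega) j (by omega)]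
    all_goals rcases j with _ | _ | _ | _ | _ | _ | j <;> first | omega | simp [m]

theorem sum_range_m {R : Type*} [CommSemiring R] (t : R) (i N : ℕ) (h : i < N) :
    ∑ j ∈ Finset.range N, (m i j : R) * t ^ j = ∑ j ∈ Finset.range (i + 1), (m i j : R) * t ^ j := by
  refine (Finset.sum_subset (Finset.range_mono h) fun j _ hj => ?_).symm
  rw [Finset.mem_range, not_lt] at hj
  rw [m_eq_zero_of_gt i j hj, Nat.cast_zero, zero_mul]

/-- The generating polynomials of the rows of `m`. -/
theorem eq_sum_m_of_recurrence {R : Type*} [CommRing R] (t : R) (u : ℕ → R)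
    (h1 : u 1 = 5 * t) (h2 : u 2 = 5 * t + 25 * t * u 1 - 5 * t - 15 * t + 25 * t)
    (h3 : u 3 = -t - 5 * t + 15 * t + 25 * t * u 1 + 25 * t * u 2)
    (h4 : u 4 = -t + 5 * t + 15 * t * u 1 + 25 * t * u 2 + 25 * t * u 3)
    (h5 : u 5 = t + 5 * t * u 1 + 15 * t * u 2 + 25 * t * u 3 + 25 * t * u 4)
    (hrec : ∀ i, u (i + 6) = t * (25 * u (i + 5) + 25 * u (i + 4) + 15 * u (i + 3) +
      5 * u (i + 2) + u (i + 1)))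
    (i N : ℕ) (hi : 1 ≤ i) (hN : i < N) :
    u i = ∑ j ∈ Finset.range N, (m i j : R) * t ^ j := by
  rw [sum_range_m t i N hN]
  clear hN
  induction i using Nat.strong_induction_on with
  | _ i ih =>
    match i, hi with
    | 1, _ => simp [Finset.sum_range_succ, m, h1]
    | 2, _ =>
      simp [Finset.sum_range_succ, m, h2, h1]
      ring
    | 3, _ =>
      simp [Finset.sum_range_succ, m, h3, h2, h1]
      ring
    | 4, _ =>
      simp [Finset.sum_range_succ, m, h4, h3, h2, h1]
      ring
    | 5, _ =>
      simp [Finset.sum_range_succ, m, h5, h4, h3, h2, h1]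
      ring
    | i + 6, _ =>
      rw [hrec, ih _ (by omega) (by omega), ih _ (by omega) (by omega), ih _ (by omega) (by omega),
        ih _ (by omega) (by omega), ih _ (by omega) (by omega),
        Finset.sum_range_succ' _ (i + 6), m_zero_right, ← sum_range_m t (i + 4) (i + 6) (by omega),
        ← sum_range_m t (i + 3) (i + 6) (by omega), ← sum_range_m t (i + 2) (i + 6) (by omega),
        ← sum_range_m t (i + 1) (i + 6) (by omega)]
      simp only [Finset.mul_sum, ← Finset.sum_add_distrib]
      rw [Nat.cast_zero, zero_mul, add_zero]
      refine Finset.sum_congr rfl fun j _ => ?_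
      rw [m_succ_right]
      push_cast
      ring

theorem section5_zero_pow (i N : ℕ) (hi : 1 ≤ i) (hN : i < N) :
    section5 0 ((X * expand5 (E 5) * (E 1)⁻¹) ^ i) =
      ∑ j ∈ Finset.range N, (m i j : ℚ⟦X⟧) * (X * E 5 ^ 6 * (E 1)⁻¹ ^ 6) ^ j := by
  have hP := E_mul_inv 1 one_ne_zero
  have hD := E_mul_inv 5 (by norm_num)
  have hmod := modular_equation
  obtain ⟨y0, y1, y2, y3, y4⟩ := section5_zero_X_pow_mul
  have hφ : expand5 (E 1)⁻¹ = (E 5)⁻¹ := by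
    have h := congrArg expand5 hP
    rw [map_mul, map_one, ← E_eq_expand] at h
    calc _ = (E 5 * (E 5)⁻¹) * expand5 (E 1)⁻¹ := by rw [hD, one_mul]
      _ = (E 5 * expand5 (E 1)⁻¹) * (E 5)⁻¹ := by ring
      _ = _ := by rw [h, one_mul]
  have hsec : ∀ g f, section5 0 (expand5 g * f) = g * section5 0 f :=
    section5_expand5_mul 0 (by norm_num)
  have hsn : ∀ a f, section5 0 (Nat.cast a * f) = a * section5 0 f :=
    section5_natCast_mul 0 (by norm_num)
  generalize hQ : (E 1)⁻¹ = Q at *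
  generalize hG : (E 5)⁻¹ = G at *
  obtain ⟨x, hx⟩ : ∃ x, x = X * expand5 (E 5) * Q := ⟨_, rfl⟩
  obtain ⟨t, ht⟩ : ∃ t, t = X * E 5 ^ 6 * Q ^ 6 := ⟨_, rfl⟩
  have hφt : expand5 t = X ^ 5 * expand5 (E 5) ^ 6 * G ^ 6 := by
    rw [ht, map_mul, map_mul, map_pow, map_pow, expand_X, hφ]
  have hw : ∀ (k : ℕ) (hk : k ≤ 4) (a : ℚ⟦X⟧),
      section5 0 (X ^ (5 - k) * E 1 ^ k) = a * X * E 5 ^ k →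
      section5 0 (X ^ (5 - k) * expand5 (E 5) ^ (6 - k) * E 1 ^ k * G ^ 6) = a * t := by
    intro k hk a ha
    have h1 : X ^ (5 - k) * expand5 (E 5) ^ (6 - k) * E 1 ^ k * G ^ 6 =
        expand5 (E 5 ^ (6 - k) * Q ^ 6) * (X ^ (5 - k) * E 1 ^ k) := by
      rw [map_mul, map_pow, map_pow, hφ]
      ring
    have h2 : E 5 ^ 6 = E 5 ^ (6 - k) * E 5 ^ k := by
      rw [← pow_add]
      congr 1
      omega
    rw [h1, hsec, ha, ht, h2]
    ring
  -- `w k` stands for `t(q⁵) x⁻ᵏ`, written without negative powers of `x`, which are not power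
  -- series. The relation `w (k + 1) * x = w k` replaces the division.
  obtain ⟨w, hwd⟩ : ∃ w : ℕ → ℚ⟦X⟧, ∀ k,
      w k = X ^ (5 - k) * expand5 (E 5) ^ (6 - k) * E 1 ^ k * G ^ 6 := ⟨_, fun _ => rfl⟩
  have hw0 : section5 0 (w 0) = t := by
    rw [hwd, hw 0 (by norm_num) 1 (by simpa using y0), one_mul]
  have hw1 : section5 0 (w 1) = -t := by
    rw [hwd, hw 1 (by norm_num) (-1) (by simpa using y1), neg_one_mul]
  have hw2 : section5 0 (w 2) = -t := by
    rw [hwd, hw 2 (by norm_num) (-1) (by simpa using y2), neg_one_mul]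
  have hw3 : section5 0 (w 3) = 5 * t := by rw [hwd, hw 3 (by norm_num) 5 (by simpa using y3)]
  have hw4 : section5 0 (w 4) = -5 * t := by rw [hwd, hw 4 (by norm_num) (-5) (by simpa using y4)]
  have hwx : ∀ k < 4, w (k + 1) * x = w k := by
    intro k hk
    rw [hwd, hwd, hx, show 5 - k = 5 - (k + 1) + 1 by omega, show 6 - k = 6 - (k + 1) + 1 by omega]
    linear_combination X ^ (5 - (k + 1) + 1) * expand5 (E 5) ^ (6 - (k + 1) + 1) * E 1 ^ k *
      G ^ 6 * hP
  have hw0t : w 0 = expand5 t := by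
    rw [hwd, hφt]
    ring
  have hD6 : E 5 ^ 6 * G ^ 6 = 1 := by rw [← mul_pow, hD, one_pow]
  -- This is the modular equation multiplied by `x / E₅⁶`. Repeated multiplication by `x` then gives
  -- the next powers, ending with the quintic for `x`.
  have hx1 : x = w 4 + 5 * w 3 + 15 * w 2 + 25 * w 1 + 25 * w 0 := by
    simp only [hwd, hx]
    generalize expand5 (E 5) = e at *
    norm_num
    linear_combination -(X * e * Q) * hD6 + X * e * Q * G ^ 6 * hmod +
      X * e * G ^ 6 * (e * E 1 ^ 4 + 5 * X * e ^ 2 * E 1 ^ 3 + 15 * X ^ 2 * e ^ 3 * E 1 ^ 2 +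
        25 * X ^ 3 * e ^ 4 * E 1 + 25 * X ^ 4 * e ^ 5) * hP
  have h43 := hwx 3 (by norm_num)
  have h32 := hwx 2 (by norm_num)
  have h21 := hwx 1 (by norm_num)
  have h10 := hwx 0 (by norm_num)
  norm_num at h43 h32 h21 h10
  have hx2 : x ^ 2 = w 3 + 5 * w 2 + 15 * w 1 + 25 * w 0 + 25 * (expand5 t * x ^ 1) := by
    rw [← hw0t]
    linear_combination x * hx1 + h43 + 5 * h32 + 15 * h21 + 25 * h10
  have hx3 : x ^ 3 = w 2 + 5 * w 1 + 15 * w 0 + 25 * (expand5 t * x ^ 1) +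
      25 * (expand5 t * x ^ 2) := by
    linear_combination x * hx2 + h32 + 5 * h21 + 15 * h10 + 25 * x * hw0t
  have hx4 : x ^ 4 = w 1 + 5 * w 0 + 15 * (expand5 t * x ^ 1) + 25 * (expand5 t * x ^ 2) +
      25 * (expand5 t * x ^ 3) := by
    linear_combination x * hx3 + h21 + 5 * h10 + 15 * x * hw0t
  have hx5 : x ^ 5 = w 0 + 5 * (expand5 t * x ^ 1) + 15 * (expand5 t * x ^ 2) +
      25 * (expand5 t * x ^ 3) + 25 * (expand5 t * x ^ 4) := by
    linear_combination x * hx4 + h10 + 5 * x * hw0t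
  have hrec : ∀ i, x ^ (i + 6) = expand5 t * (25 * x ^ (i + 5) + 25 * x ^ (i + 4) +
      15 * x ^ (i + 3) + 5 * x ^ (i + 2) + x ^ (i + 1)) := by
    intro i
    linear_combination x ^ (i + 1) * hx5 + x ^ (i + 1) * hw0t
  have hs5 : ∀ f, section5 0 (5 * f) = 5 * section5 0 f := fun f => by
    simpa only [map_ofNat] using hsec 5 f
  have hs15 : ∀ f, section5 0 (15 * f) = 15 * section5 0 f := fun f => by
    simpa only [map_ofNat] using hsec 15 f
  have hs25 : ∀ f, section5 0 (25 * f) = 25 * section5 0 f := fun f => by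
    simpa only [map_ofNat] using hsec 25 f
  rw [← hx, ← ht]
  refine eq_sum_m_of_recurrence t (fun i => section5 0 (x ^ i)) ?_ ?_ ?_ ?_ ?_ ?_ i N hi hN
  · rw [pow_one, hx1]
    simp only [section5_add, hs5, hs15, hs25, hw0, hw1, hw2, hw3, hw4]
    ring
  · rw [hx2]
    simp only [section5_add, hs5, hs15, hs25, hsec, hw0, hw1, hw2, hw3]
    ring
  · rw [hx3]
    simp only [section5_add, hs5, hs15, hs25, hsec, hw0, hw1, hw2]
    ring
  · rw [hx4]
    simp only [section5_add, hs5, hs15, hs25, hsec, hw0, hw1]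
    ring
  · rw [hx5]
    simp only [section5_add, hs5, hs15, hs25, hsec, hw0]
    ring
  · intro i
    rw [hrec, hsec]
    simp only [section5_add, hs5, hs15, hs25]

/-- The action of `section5` on powers of `E 1`. -/
theorem E_five_pow_mul_section5_zero (i N : ℕ) (hi : 1 ≤ i) (hN : i < N) :
    E 5 ^ i * section5 0 (X ^ i * (E 1)⁻¹ ^ i) =
      ∑ j ∈ Finset.range N, (m i j : ℚ⟦X⟧) * (X ^ j * E 5 ^ (6 * j) * (E 1)⁻¹ ^ (6 * j)) := by
  rw [← section5_expand5_mul 0 (by norm_num), map_pow]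
  have h := section5_zero_pow i N hi hN
  simp only [mul_pow, ← pow_mul] at h
  rw [← h]
  congr 1
  ring

/-! ### The iteration from one row of `c` to the next. -/

/-- One step of the iteration: `f` is a term of the expansion of a generating function. -/
theorem section5_term (l r a b d s : ℕ) (hs : s < 5) (hr : r + s = 9) (hr6 : 6 ≤ r)
    (ha : a + b = 6 * l + 12) (hd : d + r = 12)
    (K : ℕ) (hK : 5 * l + r + 4 ≤ K) :
    section5 s (X ^ l * E 5 ^ a * (E 1)⁻¹ ^ (6 * (l + 1) + r)) =
      ∑ k ∈ Finset.range K, (m (6 * (l + 1) + r) (l + 1 + (k + 1) + 1) : ℚ⟦X⟧) *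
        (X ^ k * E 5 ^ (6 * k + d) * (E 1)⁻¹ ^ (6 * k + 6 + b)) := by
  have hP := E_mul_inv 1 one_ne_zero
  -- The factor `X ^ (l + 1)` enters the section as `X ^ (5(l + 1))`, and `X ^ 2` turns residue `s`
  -- into residue 0 at the cost of `X ^ (10 - s) = X ^ (r + 1)`. With `X ^ l` the exponents total
  -- `6(l + 1) + r`, matching that of `(E 1)⁻¹`.
  have h1 : X ^ (l + 3) * section5 s (X ^ l * E 5 ^ a * (E 1)⁻¹ ^ (6 * (l + 1) + r)) =
      E 1 ^ a * section5 0 (X ^ (6 * (l + 1) + r) * (E 1)⁻¹ ^ (6 * (l + 1) + r)) := by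
    rw [pow_add X l 3, pow_succ X 2, mul_comm (X ^ 2) X, ← mul_assoc, ← pow_succ, mul_assoc,
      X_sq_mul_section5 s hs, ← section5_expand5_mul 0 (by norm_num),
      ← section5_expand5_mul 0 (by norm_num), map_pow, map_pow, expand_X,
      ← E_eq_expand 5 (by norm_num), show 10 - s = r + 1 by omega]
    congr 1
    ring
  have hX : (X : ℚ⟦X⟧) ^ (l + 3) ≠ 0 := pow_ne_zero _ X_ne_zero
  refine mul_left_cancel₀ (mul_ne_zero (E_pow_ne_zero 5 (by norm_num) (6 * (l + 1) + r)) hX) ?_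
  rw [mul_assoc, h1, mul_left_comm,
    E_five_pow_mul_section5_zero (6 * (l + 1) + r) (l + 3 + K) (by omega) (by omega),
    Finset.sum_range_add, Finset.sum_eq_zero, zero_add, Finset.mul_sum, Finset.mul_sum]
  · refine Finset.sum_congr rfl fun k _ => ?_
    have e1 : (E 1) ^ a * (E 1)⁻¹ ^ (6 * (l + 3 + k)) = (E 1)⁻¹ ^ (6 * k + 6 + b) := by
      rw [show 6 * (l + 3 + k) = a + (6 * k + 6 + b) by omega, pow_mul_pow_of_mul_eq_one hP]
    have e2 : E 5 ^ (6 * (l + 3 + k)) = E 5 ^ (6 * (l + 1) + r) * E 5 ^ (6 * k + d) := by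
      rw [← pow_add]
      congr 1
      omega
    rw [← e1, e2, show l + 1 + (k + 1) + 1 = l + 3 + k by omega]
    ring
  -- Columns `j < l + 3` vanish because `6(l + 1) + r > 5j`, where `r ≥ 6` is needed; this is what
  -- permits cancelling `X ^ (l + 3)`.
  · intro j hj
    rw [Finset.mem_range] at hj
    rw [m_eq_zero_of_lt _ _ (by omega), Nat.cast_zero, zero_mul]

/-- The recurrence for `c` as a finite sum. -/
theorem c_succ_eq_sum (j k B r : ℕ) (hr : r = if Odd (j + 1) then 6 else 7)
    (hB : ∀ i, B < i → c (j + 1) i = 0) :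
    c (j + 2) k =
      ∑ i ∈ Finset.range B, c (j + 1) (i + 1) * m (6 * (i + 1) + r) (i + 1 + k + 1) := by
  have h : c (j + 2) k = ∑ᶠ i ∈ Set.Ici 1, c (j + 1) i * m (6 * i + r) (i + k + 1) := by
    rw [c, hr]
    split_ifs <;> rfl
  rw [h, finsum_mem_eq_sum_of_inter_support_eq (t := Finset.Ico 1 (B + 1)),
    Finset.sum_Ico_eq_sum_range, Nat.add_sub_cancel]
  · exact Finset.sum_congr rfl fun i _ => by rw [add_comm 1 i]
  · ext i
    simp only [Set.mem_inter_iff, Set.mem_Ici, Function.mem_support, Finset.coe_Ico, Set.mem_Ico]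
    refine and_congr_left fun hi => ⟨fun h1 => ⟨h1, ?_⟩, fun h1 => h1.1⟩
    by_contra hlt
    exact hi (by rw [hB i (by omega), zero_mul])

theorem c_eq_zero_of_gt (j k B r : ℕ) (hr : r = if Odd (j + 1) then 6 else 7)
    (hB : ∀ i, B < i → c (j + 1) i = 0) (hk : 5 * B + r < k) : c (j + 2) k = 0 := by
  rw [c_succ_eq_sum j k B r hr hB]
  refine Finset.sum_eq_zero fun i hi => ?_
  rw [Finset.mem_range] at hi
  rw [m_eq_zero_of_gt _ _ (by omega), mul_zero]

theorem section5_sum_c (j B r b d s a : ℕ) (hr : r = if Odd (j + 1) then 6 else 7)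
    (hB : ∀ i, B < i → c (j + 1) i = 0) (hs : s < 5) (hrs : r + s = 9) (hr6 : 6 ≤ r)
    (ha : a + b = 12) (hd : d + r = 12) :
    section5 s (∑ l ∈ Finset.range B, (c (j + 1) (l + 1) : ℚ⟦X⟧) *
      (X ^ l * E 5 ^ (6 * l + a) * (E 1)⁻¹ ^ (6 * l + 6 + r))) =
    ∑ k ∈ Finset.range (5 * B + r + 4), (c (j + 2) (k + 1) : ℚ⟦X⟧) *
      (X ^ k * E 5 ^ (6 * k + d) * (E 1)⁻¹ ^ (6 * k + 6 + b)) := by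
  have h : ∀ l ∈ Finset.range B, section5 s ((c (j + 1) (l + 1) : ℚ⟦X⟧) *
      (X ^ l * E 5 ^ (6 * l + a) * (E 1)⁻¹ ^ (6 * l + 6 + r))) =
      ∑ k ∈ Finset.range (5 * B + r + 4), ((c (j + 1) (l + 1) *
        m (6 * (l + 1) + r) (l + 1 + (k + 1) + 1) : ℕ) : ℚ⟦X⟧) *
        (X ^ k * E 5 ^ (6 * k + d) * (E 1)⁻¹ ^ (6 * k + 6 + b)) := by
    intro l hl
    rw [Finset.mem_range] at hl
    rw [section5_natCast_mul s hs, show 6 * l + 6 + r = 6 * (l + 1) + r by ring,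
      section5_term l r (6 * l + a) b d s hs hrs hr6 (by omega) hd (5 * B + r + 4) (by omega),
      Finset.mul_sum]
    refine Finset.sum_congr rfl fun k _ => ?_
    push_cast
    ring
  rw [section5_finsetSum, Finset.sum_congr rfl h, Finset.sum_comm]
  refine Finset.sum_congr rfl fun k _ => ?_
  rw [c_succ_eq_sum j (k + 1) B r hr hB, Nat.cast_sum, Finset.sum_mul]

/-- The series on the right-hand side of the main theorem has finitely many terms and sums up to
`f`. -/
def HasExpansion (j a b : ℕ) (f : ℚ⟦X⟧) : Prop :=
  ∃ B, (∀ i, B < i → c j i = 0) ∧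
    f = ∑ l ∈ Finset.range B, (c j (l + 1) : ℚ⟦X⟧) *
      (X ^ l * E 5 ^ (6 * l + a) * (E 1)⁻¹ ^ (6 * l + 6 + b))

theorem HasExpansion.section5_of_odd {j : ℕ} (hj : Odd (j + 1)) {f : ℚ⟦X⟧}
    (h : HasExpansion (j + 1) 5 6 f) : HasExpansion (j + 2) 6 7 (section5 3 f) := by
  obtain ⟨B, hB, rfl⟩ := h
  have hr : 6 = if Odd (j + 1) then 6 else 7 := by rw [if_pos hj]
  exact ⟨5 * B + 6 + 4, fun i hi => c_eq_zero_of_gt j i B 6 hr hB (by omega),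
    section5_sum_c j B 6 7 6 3 5 hr hB (by norm_num) rfl le_rfl rfl rfl⟩

theorem HasExpansion.section5_of_even {j : ℕ} (hj : ¬ Odd (j + 1)) {f : ℚ⟦X⟧}
    (h : HasExpansion (j + 1) 6 7 f) : HasExpansion (j + 2) 5 6 (section5 2 f) := by
  obtain ⟨B, hB, rfl⟩ := h
  have hr : 7 = if Odd (j + 1) then 6 else 7 := by rw [if_neg hj]
  exact ⟨5 * B + 7 + 4, fun i hi => c_eq_zero_of_gt j i B 7 hr hB (by omega),
    section5_sum_c j B 7 6 5 2 6 hr hB (by norm_num) rfl (by norm_num) rfl rfl⟩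

theorem mk_pNeg_seven : (PowerSeries.mk fun n => (pNeg 7 n : ℚ)) = (E 1)⁻¹ ^ 7 := by
  have hP := E_mul_inv 1 one_ne_zero
  calc _ = (PowerSeries.mk fun n => (pNeg 7 n : ℚ)) * E 1 ^ 7 * (E 1)⁻¹ ^ 7 := by
        rw [mul_assoc, ← mul_pow, hP, one_pow, mul_one]
    _ = _ := by rw [mk_pNeg, one_mul]

/-- After multiplication by `E₅⁷ X²` this is the central formula at `i = 7`. Since `m(7, 1) = 0`,
the factor `X²` cancels and `c(1, k) = m(7, k + 1)`. -/
theorem hasExpansion_one :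
    HasExpansion 1 5 6 (section5 3 (PowerSeries.mk fun n => (pNeg 7 n : ℚ))) := by
  refine ⟨6, fun i hi => ?_, ?_⟩
  · obtain ⟨i, rfl⟩ : ∃ k, i = k + 7 := ⟨i - 7, by omega⟩
    simp [c]
  · refine mul_left_cancel₀ (mul_ne_zero (E_pow_ne_zero 5 (by norm_num) 7)
      (pow_ne_zero 2 (X_ne_zero (R := ℚ)))) ?_
    rw [mul_assoc, X_sq_mul_section5 3 (by norm_num), mk_pNeg_seven,
      E_five_pow_mul_section5_zero 7 8 (by norm_num) (by norm_num)]
    simp [Finset.sum_range_succ, m, c]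
    ring

theorem mk_pNeg_hasExpansion (i : ℕ) :
    HasExpansion (2 * i + 1) 5 6 (PowerSeries.mk fun n =>
      (pNeg 7 (5 ^ (2 * i + 1) * n + (13 * 5 ^ (2 * i + 1) + 7) / 24) : ℚ)) ∧
    HasExpansion (2 * i + 2) 6 7 (PowerSeries.mk fun n =>
      (pNeg 7 (5 ^ (2 * i + 2) * n + (17 * 5 ^ (2 * i + 2) + 7) / 24) : ℚ)) := by
  have hodd : ∀ i, HasExpansion (2 * i + 1) 5 6 (PowerSeries.mk fun n =>
      (pNeg 7 (5 ^ (2 * i + 1) * n + (13 * 5 ^ (2 * i + 1) + 7) / 24) : ℚ)) →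
      HasExpansion (2 * i + 2) 6 7 (PowerSeries.mk fun n =>
      (pNeg 7 (5 ^ (2 * i + 2) * n + (17 * 5 ^ (2 * i + 2) + 7) / 24) : ℚ)) := by
    intro i h
    convert h.section5_of_odd (by simp) using 1
    ext n
    rw [coeff_section5, coeff_mk, coeff_mk]
    congr 2
    -- The residue 3 is right because `13 + 24 · 3 = 5 · 17`.
    obtain ⟨d1, d2⟩ := dvd_index (i + 1) (by omega)
    rw [show 2 * (i + 1) - 1 = 2 * i + 1 by omega] at d1
    rw [show 2 * (i + 1) = 2 * i + 1 + 1 by omega, pow_succ] at d2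
    rw [pow_succ 5 (2 * i + 1)]
    generalize 5 ^ (2 * i + 1) = y at *
    have e1 : y * 5 * n = 5 * (y * n) := by ring
    have e2 : y * (5 * n + 3) = 5 * (y * n) + 3 * y := by ring
    rw [e1, e2]
    omega
  have heven : ∀ i, HasExpansion (2 * i + 2) 6 7 (PowerSeries.mk fun n =>
      (pNeg 7 (5 ^ (2 * i + 2) * n + (17 * 5 ^ (2 * i + 2) + 7) / 24) : ℚ)) →
      HasExpansion (2 * i + 3) 5 6 (PowerSeries.mk fun n =>
      (pNeg 7 (5 ^ (2 * i + 3) * n + (13 * 5 ^ (2 * i + 3) + 7) / 24) : ℚ)) := by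
    intro i h
    convert h.section5_of_even (by grind) using 1
    ext n
    rw [coeff_section5, coeff_mk, coeff_mk]
    congr 2
    -- The residue 2 is right because `17 + 24 · 2 = 5 · 13`.
    have d2 := (dvd_index (i + 1) (by omega)).2
    have d1 := (dvd_index (i + 2) (by omega)).1
    rw [show 2 * (i + 2) - 1 = 2 * i + 2 + 1 by omega, pow_succ] at d1
    rw [show 2 * (i + 1) = 2 * i + 2 by omega] at d2
    rw [pow_succ 5 (2 * i + 2)]
    generalize 5 ^ (2 * i + 2) = y at *
    have e1 : y * 5 * n = 5 * (y * n) := by ring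
    have e2 : y * (5 * n + 2) = 5 * (y * n) + 2 * y := by ring
    rw [e1, e2]
    omega
  have h : ∀ i, HasExpansion (2 * i + 1) 5 6 (PowerSeries.mk fun n =>
      (pNeg 7 (5 ^ (2 * i + 1) * n + (13 * 5 ^ (2 * i + 1) + 7) / 24) : ℚ)) := by
    intro i
    induction i with
    | zero =>
      convert hasExpansion_one using 1
      ext n
      simp
    | succ i ih => exact heven i (hodd i ih)
  exact ⟨h i, hodd i (h i)⟩

theorem HasExpansion.hasSum {j a b : ℕ} {f : ℚ⟦X⟧} (h : HasExpansion j a b f) :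
    HasSum (fun l : ℕ => (c j (l + 1) : ℚ) •
      (X ^ l * E 5 ^ (6 * l + a) * (E 1 ^ (6 * l + 6 + b))⁻¹)) f := by
  obtain ⟨B, hB, rfl⟩ := h
  have h1 : ∀ l : ℕ, (c j (l + 1) : ℚ⟦X⟧) *
      (X ^ l * E 5 ^ (6 * l + a) * (E 1)⁻¹ ^ (6 * l + 6 + b)) = (c j (l + 1) : ℚ) •
      (X ^ l * E 5 ^ (6 * l + a) * (E 1 ^ (6 * l + 6 + b))⁻¹) := by
    intro l
    rw [E_pow_inv 1 one_ne_zero, Nat.cast_smul_eq_nsmul, nsmul_eq_mul]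
  simp only [h1]
  refine hasSum_sum_of_ne_finset_zero fun l hl => ?_
  rw [Finset.mem_range, not_lt] at hl
  rw [hB (l + 1) (by omega), Nat.cast_zero, zero_smul]

end ColoredPartitions

theorem mainTheorem7 (j : ℕ) (hj : 1 ≤ j) :
    HasSum
      (fun l : ℕ+ =>
        (ColoredPartitions.c (2 * j - 1) l : ℚ) •
          ((PowerSeries.X : PowerSeries ℚ) ^ ((l : ℕ) - 1) *
            ColoredPartitions.E 5 ^ (6 * (l : ℕ) - 1) *
            (ColoredPartitions.E 1 ^ (6 * (l : ℕ) + 6))⁻¹))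
      (PowerSeries.mk fun n : ℕ =>
        (ColoredPartitions.pNeg 7
          (5 ^ (2 * j - 1) * n + (13 * 5 ^ (2 * j - 1) + 7) / 24) : ℚ)) ∧
    HasSum
      (fun l : ℕ+ =>
        (ColoredPartitions.c (2 * j) l : ℚ) •
          ((PowerSeries.X : PowerSeries ℚ) ^ ((l : ℕ) - 1) *
            ColoredPartitions.E 5 ^ (6 * (l : ℕ)) *
            (ColoredPartitions.E 1 ^ (6 * (l : ℕ) + 7))⁻¹))
      (PowerSeries.mk fun n : ℕ =>
        (ColoredPartitions.pNeg 7
          (5 ^ (2 * j) * n + (17 * 5 ^ (2 * j) + 7) / 24) : ℚ)) := by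
  obtain ⟨i, rfl⟩ : ∃ i, j = i + 1 := ⟨j - 1, by omega⟩
  obtain ⟨h1, h2⟩ := ColoredPartitions.mk_pNeg_hasExpansion i
  rw [show 2 * (i + 1) - 1 = 2 * i + 1 by omega, show 2 * (i + 1) = 2 * i + 2 by omega]
  constructor
  · rw [← Equiv.pnatEquivNat.symm.hasSum_iff]
    convert h1.hasSum using 2 with l
    simp [show 6 * (l + 1) = 6 * l + 6 by omega]
  · rw [← Equiv.pnatEquivNat.symm.hasSum_iff]
    convert h2.hasSum using 2 with l
    simp [show 6 * (l + 1) = 6 * l + 6 by omega]
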